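/- A VASS of dimension $n\ge 1$ is a triple $\mathcal V=(Q,n,\delta)$ with $Q$ a nonempty finite set of control states and $\delta\subseteq Q\times\mathbb Z^n\times Q$ finite. A configuration is an element of $Q\times\mathbb N^n$. We write $(q,\mathbf x)\to(q',\mathbf x')$ if $(q,\mathbf b,q')\in\delta$ for some $\mathbf b$ with $\mathbf x'=\mathbf x+\mathbf b$. A run is a nonempty sequence of configurations in which consecutive ones are related by $\to$. For $X\subseteq\{1,\dots,n\}$, the initialized VASS $(\mathcal V,(q_0,\mathbf x_0))$ is simultaneously $X$-unbounded if for every $B\ge 0$ there is a finite run from $(q_0,\mathbf x_0)$ to some $(q,\mathbf y)$ with $\mathbf y(i)\ge B$ for all $i\in X$. It is $i$-unbounded if it is simultaneously $\{i\}$-unbounded. A disjointness sequence is a nonempty sequence $\sigma=X_1\cdots X_K$ of nonempty, pairwise disjoint subsets of $\{1,\dots,n\}$. A finite run satisfies $\mathrm{PB}_\sigma$ if it can be decomposed as $$(q_0,\mathbf x_0)\xrightarrow{\pi_0'}(q_1,\mathbf x_1)\xrightarrow{\pi_1}(q_2,\mathbf x_2)\xrightarrow{\pi_1'}\cdots\xrightarrow{\pi_{K-1}'}(q_{2K-1},\mathbf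 x_{2K-1})\xrightarrow{\pi_K}(q_{2K},\mathbf x_{2K})$$ such that for every $l\in\{1,\dots,K\}$: - $q_{2l-1}=q_{2l}$; - $\mathbf x_{2l-1}(j)<\mathbf x_{2l}(j)$ for all $j\in X_l$; - for all $j\in\{1,\dots,n\}\setminus X_l$, $\mathbf x_{2l}(j)<\mathbf x_{2l-1}(j)$ implies $j\in\bigcup_{1\le l'<l}X_{l'}$. **Lemma.** Let $(\mathcal V,(q_0,\mathbf x_0))$ be an initialized VASS of dimension $n$ and let $X\subseteq\{1,\dots,n\}$ be nonempty. Then $(\mathcal V,(q_0,\mathbf x_0))$ is simultaneously $X$-unbounded if and only if there is a run starting at $(q_0,\mathbf x_0)$ that satisfies $\mathrm{PB}_\sigma$ for some disjointness sequence $\sigma=X_1\cdots X_K$ with $X\subseteq X_1\cup\cdots\cup X_K$ and $X\cap X_K\ne\emptyset$. Consequently, for every $i\in\{1,\dots,n\}$, $(\mathcal V,(q_0,\mathbf x_0))$ is $i$-unbounded if and only if there is a run starting at $(q_0,\mathbf x_0)$ that satisfies $\mathrm{PB}_\sigma$ for some disjointness sequence $\sigma=X_1\cdots X_K$ with $i\in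 X_K$. -/

import Mathlib

/-- A vector addition system with states, with control states `Q` and dimension `n`, given by its
finite transition relation `δ ⊆ Q × ℤⁿ × Q`. Finiteness of `Q` is a hypothesis where it is used. -/
structure VASS (Q : Type*) (n : ℕ) where
  /-- The transition relation. -/
  trans : Finset (Q × (Fin n → ℤ) × Q)

namespace VASS

/-- Configurations: elements of `Q × ℕⁿ`. -/
abbrev Config (Q : Type*) (n : ℕ) : Type _ := Q × (Fin n → ℕ)

/-- `(q, x) → (q', x')`: there is a transition `(q, b, q')` of the system with `x' = x + b`. -/
def Step {Q : Type*} {n : ℕ} (V : VASS Q n) (c c' : Config Q n) : Prop :=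
  ∃ b : Fin n → ℤ, (c.1, b, c'.1) ∈ V.trans ∧ ∀ i : Fin n, (c'.2 i : ℤ) = (c.2 i : ℤ) + b i

/-- A finite run: a nonempty finite sequence of configurations, each obtained from the preceding
one by a transition; `length` is the number of transitions. -/
structure Run {Q : Type*} {n : ℕ} (V : VASS Q n) where
  /-- The number of transitions. -/
  length : ℕ
  /-- The configurations of the run. -/
  conf : Fin (length + 1) → Config Q n
  step : ∀ i : Fin length, V.Step (conf i.castSucc) (conf i.succ)

/-- The first configuration of a run. -/
def Run.first {Q : Type*} {n : ℕ} {V : VASS Q n} (ρ : V.Run) : Config Q n := ρ.conf 0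

/-- The last configuration of a run. -/
def Run.last {Q : Type*} {n : ℕ} {V : VASS Q n} (ρ : V.Run) : Config Q n :=
  ρ.conf (Fin.last ρ.length)

/-- Simultaneous `X`-unboundedness of the initialized VASS `(V, c₀)`. -/
def SimUnbounded {Q : Type*} {n : ℕ} (V : VASS Q n) (c₀ : Config Q n) (X : Set (Fin n)) : Prop :=
  ∀ B : ℕ, ∃ ρ : V.Run, ρ.first = c₀ ∧ ∀ i ∈ X, B ≤ ρ.last.2 i

/-- `i`-unboundedness (place unboundedness) of the initialized VASS `(V, c₀)`. -/
def PlaceUnbounded {Q : Type*} {n : ℕ} (V : VASS Q n) (c₀ : Config Q n) (i : Fin n) : Prop :=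
  V.SimUnbounded c₀ {i}

/-- A disjointness sequence `X_1 ⋯ X_K`: a nonempty sequence of nonempty, pairwise disjoint sets
of components. The sets are indexed from `0` to `K - 1`. -/
structure DisjointnessSeq (n : ℕ) where
  /-- The length `K` of the sequence. -/
  K : ℕ
  K_pos : 0 < K
  /-- The members of the sequence. -/
  X : Fin K → Set (Fin n)
  nonempty : ∀ l, (X l).Nonempty
  disjoint : ∀ l l', l ≠ l' → X l ∩ X l' = ∅

/-- The last index of a disjointness sequence. -/
def DisjointnessSeq.lastIdx {n : ℕ} (σ : DisjointnessSeq n) : Fin σ.K :=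
  ⟨σ.K - 1, Nat.sub_lt σ.K_pos Nat.one_pos⟩

/-- The run `ρ` satisfies `PB_σ`. The functions `s` and `e` give a decomposition of `ρ`: `s l` and
`e l` are the positions in `ρ` where the segment `π_l` starts and ends, that is, the positions of
the configurations with numbers `2l - 1` and `2l`. All segments may be empty as far as the
decomposition is concerned, and the last segment `π_K` ends where `ρ` ends. -/
def Run.SatisfiesPB {Q : Type*} {n : ℕ} {V : VASS Q n} (ρ : V.Run) (σ : DisjointnessSeq n) :
    Prop :=
  ∃ s e : Fin σ.K → Fin (ρ.length + 1),
    -- `s 1 ≤ e 1 ≤ s 2 ≤ e 2 ≤ ⋯ ≤ s K ≤ e K`, the end of the run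
    (∀ l, s l ≤ e l) ∧ (∀ l l', l < l' → e l ≤ s l') ∧ e σ.lastIdx = Fin.last ρ.length ∧
    -- (P0)
    (∀ l, (ρ.conf (s l)).1 = (ρ.conf (e l)).1) ∧
    -- (STRICT)
    (∀ l, ∀ j ∈ σ.X l, (ρ.conf (s l)).2 j < (ρ.conf (e l)).2 j) ∧
    -- (NONSTRICT)
    (∀ l, ∀ j ∉ σ.X l, (ρ.conf (e l)).2 j < (ρ.conf (s l)).2 j → ∃ l' < l, j ∈ σ.X l')

end VASS

/-!
For the direct implication, König's lemma gives an infinite path without repetitions through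
`X`-unbounded configurations, and Dickson's lemma gives on it a loop from `s` to some `e ≥ s`, with
`e ≠ s` and the same state. The set `A` of the components that this loop increases is the first
block. When the components in `A` are frozen, fewer components remain active and `e` is still
`X \ A`-unbounded; by induction there is a suitable run of the frozen system from `e`. It is a run
of the original system as soon as the components in `A` are large enough, which is achieved by
iterating the loop.

For the converse, the segments are pumped from the first to the last. A segment may decrease only
components of earlier blocks, so these are first pumped high enough to pay for that.
-/

section Konig

open Relation Filter

variable {α : Type*} {r : α → α → Prop} {l : Filter α} {H : Set α} {a y : α}

/-- Reachability along `r` by a path all of whose vertices, except possibly the first, lie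
outside `H`. -/
def ReachAvoiding (r : α → α → Prop) (H : Set α) : α → α → Prop :=
  ReflTransGen fun a b => r a b ∧ b ∉ H

theorem ReachAvoiding.reflTransGen (h : ReachAvoiding r H a y) : ReflTransGen r a y :=
  ReflTransGen.mono (fun _ _ hab => hab.1) _ _ h

theorem reachAvoiding_empty : ReachAvoiding r ∅ = ReflTransGen r := by
  simp [ReachAvoiding]

theorem ReachAvoiding.eq_or_exists_insert (h : ReachAvoiding r H a y) :
    y = a ∨ ∃ b, r a b ∧ b ∉ insert a H ∧ ReachAvoiding r (insert a H) b y := by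
  induction h with
  | refl => exact Or.inl rfl
  | @tail y z _ hyz ih =>
    by_cases hza : z = a
    · exact Or.inl hza
    have hz : z ∉ insert a H := by simp [hza, hyz.2]
    rcases ih with rfl | ⟨b, hab, hb, hby⟩
    · exact Or.inr ⟨z, hyz.1, hz, .refl⟩
    · exact Or.inr ⟨b, hab, hb, hby.tail ⟨hyz.1, hz⟩⟩

theorem exists_frequently_reachAvoiding_insert (hr : ∀ a, {b | r a b}.Finite)
    (hl : l ≤ cofinite) (ha : ∃ᶠ y in l, ReachAvoiding r H a y) :
    ∃ b, r a b ∧ b ∉ insert a H ∧ ∃ᶠ y in l, ReachAvoiding r (insert a H) b y := by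
  have hne : ∀ᶠ y in l, y ≠ a := le_cofinite_iff_eventually_ne.mp hl a
  have hex : ∃ᶠ y in l, ∃ b ∈ {b | r a b}, b ∉ insert a H ∧ ReachAvoiding r (insert a H) b y :=
    (ha.and_eventually hne).mono fun y hy => hy.1.eq_or_exists_insert.resolve_left hy.2
  obtain ⟨b, hab, hb⟩ := (frequently_exists_finite (hr a)).mp hex
  exact ⟨b, hab, hb.exists.choose_spec.1, hb.mono fun _ h => h.2⟩

/-- For `l = cofinite` this is König's lemma; for a finer filter `l` the sequence stays among the
vertices from which `l`-frequently many, and not merely infinitely many, vertices are reachable. -/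
theorem exists_injective_seq_of_frequently_reflTransGen (hr : ∀ a, {b | r a b}.Finite)
    (hl : l ≤ cofinite) (ha : ∃ᶠ y in l, ReflTransGen r a y) :
    ∃ d : ℕ → α, d 0 = a ∧ d.Injective ∧ (∀ k, r (d k) (d (k + 1))) ∧
      ∀ k, ∃ᶠ y in l, ReflTransGen r (d k) y := by
  let S := {p : Set α × α // p.2 ∉ p.1 ∧ ∃ᶠ y in l, ReachAvoiding r p.1 p.2 y}
  have hnext : ∀ p : S, ∃ p' : S, r p.1.2 p'.1.2 ∧ p'.1.1 = insert p.1.2 p.1.1 := by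
    rintro ⟨⟨H, a⟩, -, ha⟩
    obtain ⟨b, hab, hb, hfreq⟩ := exists_frequently_reachAvoiding_insert hr hl ha
    exact ⟨⟨(insert a H, b), hb, hfreq⟩, hab, rfl⟩
  choose next hrel hvisited using hnext
  let start : S := ⟨(∅, a), Set.notMem_empty a, by rwa [reachAvoiding_empty]⟩
  let g : ℕ → S := fun k => next^[k] start
  have hg : ∀ k, g (k + 1) = next (g k) := fun k => Function.iterate_succ_apply' next k start
  have hmono : Monotone fun k => (g k).1.1 := monotone_nat_of_le_succ fun k => by
    simp only [hg, hvisited]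
    exact Set.subset_insert _ _
  have hmem : ∀ i j, i < j → (g i).1.2 ∈ (g j).1.1 := fun i j hij => hmono hij <| by
    simp only [hg, hvisited, Set.mem_insert_iff, true_or]
  refine ⟨fun k => (g k).1.2, rfl, .of_lt_imp_ne fun i j hij heq => ?_, fun k => ?_,
    fun k => (g k).2.2.mono fun _ h => h.reflTransGen⟩
  · exact (g j).2.1 (heq ▸ hmem i j hij)
  · simpa only [hg] using hrel (g k)

end Konig

namespace VASS

open Relation Filter

variable {Q : Type*} {n : ℕ} {V W : VASS Q n} {A : Set (Fin n)} {c c' s e : Config Q n}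

/-- Reachability between configurations. -/
def Reach (V : VASS Q n) : Config Q n → Config Q n → Prop :=
  ReflTransGen V.Step

/-- The configuration obtained from `c` by adding the vector `v` to its counters. -/
def shift (c : Config Q n) (v : Fin n → ℕ) : Config Q n :=
  (c.1, c.2 + v)

@[simp]
theorem shift_zero (c : Config Q n) : shift c 0 = c := by
  simp [shift]

theorem shift_shift (c : Config Q n) (v w : Fin n → ℕ) : shift (shift c v) w = shift c (v + w) := by
  simp [shift, add_assoc]

theorem exists_shift_eq_of_le (hq : s.1 = e.1) (hle : s.2 ≤ e.2) : ∃ v, e = shift s v := by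
  obtain ⟨v, hv⟩ := exists_add_of_le hle
  exact ⟨v, Prod.ext hq.symm hv⟩

theorem Step.shift (h : V.Step c c') (v : Fin n → ℕ) : V.Step (shift c v) (shift c' v) := by
  obtain ⟨b, hb, hval⟩ := h
  refine ⟨b, hb, fun i => ?_⟩
  simp only [VASS.shift, Pi.add_apply, Nat.cast_add, hval i]
  ring

theorem Reach.shift (h : V.Reach c c') (v : Fin n → ℕ) : V.Reach (shift c v) (shift c' v) :=
  ReflTransGen.lift (VASS.shift · v) (fun _ _ hstep => hstep.shift v) _ _ h

theorem Reach.iterate {v : Fin n → ℕ} (h : V.Reach s (VASS.shift s v)) (M : ℕ) :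
    V.Reach s (VASS.shift s (M • v)) := by
  induction M with
  | zero => rw [zero_smul, shift_zero]; exact .refl
  | succ M ih =>
    have hloop := h.shift (M • v)
    rw [shift_shift, ← succ_nsmul'] at hloop
    exact ih.trans hloop

theorem finite_setOf_step (V : VASS Q n) (c : Config Q n) : {c' | V.Step c c'}.Finite := by
  refine (V.trans.finite_toSet.image fun t =>
    ((t.2.2, fun i => ((c.2 i : ℤ) + t.2.1 i).toNat) : Config Q n)).subset ?_
  rintro c' ⟨b, hb, hval⟩
  exact ⟨_, hb, Prod.ext rfl <| funext fun i => by simp [← hval i]⟩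

theorem Step.mem_image_trans (h : V.Step c c') :
    c.1 ∈ Prod.fst '' (V.trans : Set (Q × (Fin n → ℤ) × Q)) :=
  let ⟨_, hb, _⟩ := h
  ⟨_, hb, rfl⟩

theorem Run.reach (ρ : V.Run) {i j : Fin (ρ.length + 1)} (hij : i ≤ j) :
    V.Reach (ρ.conf i) (ρ.conf j) := by
  induction j using Fin.induction with
  | zero => rw [Fin.le_zero_iff.mp hij]; exact .refl
  | succ j ih =>
    rcases hij.lt_or_eq with hlt | rfl
    · exact (ih (Fin.le_castSucc_iff.mpr hlt)).tail (ρ.step j)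
    · exact .refl

/-- The run consisting of a single configuration. -/
def Run.single (V : VASS Q n) (c : Config Q n) : V.Run where
  length := 0
  conf _ := c
  step i := i.elim0

/-- The run obtained from `ρ` by putting a transition in front of it. -/
def Run.cons (ρ : V.Run) (h : V.Step c ρ.first) : V.Run where
  length := ρ.length + 1
  conf := Fin.cons c ρ.conf
  step := Fin.cases h fun i => by simpa only [Fin.castSucc_succ, Fin.cons_succ] using ρ.step i

/-- The run `ρ'` ends by following `ρ`: the position `i` of `ρ` corresponds to the position `ι i`
of `ρ'`, where the configurations have the same states and agree outside the components in `A`.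
The runs may belong to different systems. -/
structure Run.EmbedsOff (A : Set (Fin n)) (ρ : W.Run) (ρ' : V.Run)
    (ι : Fin (ρ.length + 1) → Fin (ρ'.length + 1)) : Prop where
  mono : Monotone ι
  map_last : ι (Fin.last ρ.length) = Fin.last ρ'.length
  state_eq : ∀ i, (ρ'.conf (ι i)).1 = (ρ.conf i).1
  coord_eq : ∀ i, ∀ j ∉ A, (ρ'.conf (ι i)).2 j = (ρ.conf i).2 j

theorem Run.EmbedsOff.conf_eq {ρ ρ' : V.Run} {ι : Fin (ρ.length + 1) → Fin (ρ'.length + 1)}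
    (h : ρ.EmbedsOff ∅ ρ' ι) (i : Fin (ρ.length + 1)) : ρ'.conf (ι i) = ρ.conf i :=
  Prod.ext (h.state_eq i) <| funext fun j => h.coord_eq i j (Set.notMem_empty j)

theorem Run.EmbedsOff.trans {ρ : W.Run} {ρ' ρ'' : V.Run}
    {ι : Fin (ρ.length + 1) → Fin (ρ'.length + 1)}
    {κ : Fin (ρ'.length + 1) → Fin (ρ''.length + 1)}
    (h : ρ.EmbedsOff A ρ' ι) (h' : ρ'.EmbedsOff ∅ ρ'' κ) : ρ.EmbedsOff A ρ'' (κ ∘ ι) where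
  mono := h'.mono.comp h.mono
  map_last := (congrArg κ h.map_last).trans h'.map_last
  state_eq i := (h'.state_eq (ι i)).trans (h.state_eq i)
  coord_eq i j hj := (h'.coord_eq (ι i) j (Set.notMem_empty j)).trans (h.coord_eq i j hj)

theorem Reach.exists_embedsOff {ρ : V.Run} (h : V.Reach c ρ.first) :
    ∃ ρ' : V.Run, ρ'.first = c ∧ ∃ ι, ρ.EmbedsOff ∅ ρ' ι := by
  induction h using ReflTransGen.head_induction_on with
  | refl => exact ⟨ρ, rfl, id, monotone_id, rfl, fun _ => rfl, fun _ _ _ => rfl⟩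
  | @head a b hab _ ih =>
    obtain ⟨ρ', rfl, ι, hι⟩ := ih
    have hsucc : ρ'.EmbedsOff ∅ (ρ'.cons hab) Fin.succ :=
      ⟨Fin.strictMono_succ.monotone, rfl, fun _ => rfl, fun _ _ _ => rfl⟩
    exact ⟨ρ'.cons hab, rfl, _, hι.trans hsucc⟩

theorem reach_iff_exists_run : V.Reach c c' ↔ ∃ ρ : V.Run, ρ.first = c ∧ ρ.last = c' := by
  constructor
  · intro h
    obtain ⟨ρ, hfirst, ι, hι⟩ := Reach.exists_embedsOff (ρ := Run.single V c') h
    exact ⟨ρ, hfirst, (congrArg ρ.conf hι.map_last).symm.trans (hι.conf_eq _)⟩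
  · rintro ⟨ρ, rfl, rfl⟩
    exact ρ.reach (Fin.zero_le _)

theorem simUnbounded_iff_forall_exists_reach {X : Set (Fin n)} :
    V.SimUnbounded c X ↔ ∀ B : ℕ, ∃ y, V.Reach c y ∧ ∀ i ∈ X, B ≤ y.2 i := by
  simp only [SimUnbounded, reach_iff_exists_run]
  refine forall_congr' fun B => ⟨?_, ?_⟩
  · rintro ⟨ρ, hρ, hB⟩
    exact ⟨ρ.last, ⟨ρ, hρ, rfl⟩, hB⟩
  · rintro ⟨_, ⟨ρ, hρ, rfl⟩, hB⟩
    exact ⟨ρ, hρ, hB⟩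

/-- The filter of configurations whose components in `X` are simultaneously large. It is meant for
nonempty `X`: an infimum over the empty set is `0` in `ℕ`. -/
noncomputable def simLarge (Q : Type*) {n : ℕ} (X : Set (Fin n)) : Filter (Config Q n) :=
  comap (fun y => ⨅ i : X, y.2 i) atTop

theorem simLarge_le_cofinite (X : Set (Fin n)) : simLarge Q X ≤ cofinite :=
  le_cofinite_iff_eventually_ne.mpr fun x =>
    (tendsto_comap.eventually_ne_atTop (⨅ i : X, x.2 i)).mono fun _ hne heq => hne (heq ▸ rfl)

theorem simUnbounded_iff_frequently_reach {X : Set (Fin n)} (hX : X.Nonempty) :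
    V.SimUnbounded c X ↔ ∃ᶠ y in simLarge Q X, V.Reach c y := by
  have : Nonempty X := hX.to_subtype
  rw [simUnbounded_iff_forall_exists_reach, simLarge, (atTop_basis.comap _).frequently_iff]
  simp only [Set.mem_preimage, Set.mem_Ici, le_ciInf_iff (OrderBot.bddBelow _), Subtype.forall,
    forall_const, and_comm]

/-- Since transitions are finite in number, only finitely many states occur on an infinite path, so
Dickson's lemma applies. -/
theorem exists_lt_le_of_forall_step {d : ℕ → Config Q n} (hd : ∀ k, V.Step (d k) (d (k + 1))) :
    ∃ i j, i < j ∧ (d i).1 = (d j).1 ∧ (d i).2 ≤ (d j).2 := by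
  let sources : Set Q := Prod.fst '' (V.trans : Set (Q × (Fin n → ℤ) × Q))
  have : Finite sources := (V.trans.finite_toSet.image Prod.fst).to_subtype
  have hwqo : WellQuasiOrdered fun a b : sources × (Fin n → ℕ) => a.1 = b.1 ∧ a.2 ≤ b.2 :=
    (Finite.wellQuasiOrdered (· = ·)).prod wellQuasiOrdered_le
  obtain ⟨i, j, hij, hq, hle⟩ := hwqo fun k => (⟨(d k).1, (hd k).mem_image_trans⟩, (d k).2)
  exact ⟨i, j, hij, congrArg Subtype.val hq, hle⟩

theorem reach_of_forall_step {d : ℕ → Config Q n} (hd : ∀ k, V.Step (d k) (d (k + 1))) {i j : ℕ}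
    (hij : i ≤ j) : V.Reach (d i) (d j) := by
  induction j, hij using Nat.le_induction with
  | base => exact .refl
  | succ j _ ih => exact ih.tail (hd j)

theorem SimUnbounded.exists_loop {X : Set (Fin n)} (hX : X.Nonempty) (h : V.SimUnbounded c X) :
    ∃ s v, v ≠ 0 ∧ V.Reach c s ∧ V.Reach s (shift s v) ∧ V.SimUnbounded (shift s v) X := by
  obtain ⟨d, rfl, hinj, hstep, hfreq⟩ := exists_injective_seq_of_frequently_reflTransGen
    V.finite_setOf_step (simLarge_le_cofinite X) ((simUnbounded_iff_frequently_reach hX).mp h)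
  obtain ⟨i, j, hij, hq, hle⟩ := exists_lt_le_of_forall_step hstep
  obtain ⟨v, hv⟩ := exists_shift_eq_of_le hq hle
  refine ⟨d i, v, ?_, reach_of_forall_step hstep i.zero_le, hv ▸ reach_of_forall_step hstep hij.le,
    hv ▸ (simUnbounded_iff_frequently_reach hX).mpr (hfreq j)⟩
  rintro rfl
  exact hij.ne' (hinj (by simpa using hv))

open Classical in
/-- The system in which no transition changes the components in `A`; in particular these no longer
disable any transition. -/
noncomputable def freeze (V : VASS Q n) (A : Set (Fin n)) : VASS Q n where
  trans := V.trans.image fun t => (t.1, Aᶜ.indicator t.2.1, t.2.2)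

/-- The components that some transition changes. -/
def activeComponents (V : VASS Q n) : Set (Fin n) :=
  {i | ∃ t ∈ V.trans, t.2.1 i ≠ 0}

theorem activeComponents_freeze : (V.freeze A).activeComponents = V.activeComponents \ A := by
  ext i
  simp only [activeComponents, freeze, Set.mem_sdiff, Set.mem_ofPred_eq, Finset.exists_mem_image]
  by_cases hi : i ∈ A <;> simp [hi]

theorem Reach.eq_of_notMem_activeComponents (h : V.Reach c c') {i : Fin n}
    (hi : i ∉ V.activeComponents) : c'.2 i = c.2 i := by
  induction h with
  | refl => rfl
  | tail _ hstep ih =>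
    obtain ⟨b, hb, hval⟩ := hstep
    have hbi : b i = 0 := by_contra fun hne => hi ⟨_, hb, hne⟩
    rw [← ih, ← Nat.cast_inj (R := ℤ), hval i, hbi, add_zero]

theorem step_freeze_iff : (V.freeze A).Step c c' ↔ ∃ b : Fin n → ℤ, (c.1, b, c'.1) ∈ V.trans ∧
    (∀ i ∈ A, c'.2 i = c.2 i) ∧ ∀ i ∉ A, (c'.2 i : ℤ) = c.2 i + b i := by
  classical
  constructor
  · rintro ⟨_, hb, hval⟩
    obtain ⟨⟨q, b, q'⟩, ht, heq⟩ := Finset.mem_image.mp hb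
    obtain ⟨rfl, rfl, rfl⟩ : q = c.1 ∧ Aᶜ.indicator b = _ ∧ q' = c'.1 := by simpa using heq
    refine ⟨b, ht, fun i hi => ?_, fun i hi => ?_⟩
    · simpa [hi] using hval i
    · simpa [hi] using hval i
  · rintro ⟨b, hb, hA, hval⟩
    refine ⟨Aᶜ.indicator b, Finset.mem_image.mpr ⟨_, hb, rfl⟩, fun i => ?_⟩
    by_cases hi : i ∈ A
    · simp [hi, hA i hi]
    · simp [hi, hval i hi]

open Classical in
/-- The run of the frozen system that takes the same transitions as `ρ`. -/
noncomputable def Run.freeze (ρ : V.Run) (A : Set (Fin n)) : (V.freeze A).Run where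
  length := ρ.length
  conf i := ((ρ.conf i).1, A.piecewise ρ.first.2 (ρ.conf i).2)
  step i := by
    obtain ⟨b, hb, hval⟩ := ρ.step i
    exact step_freeze_iff.mpr ⟨b, hb, fun j hj => by simp [hj], fun j hj => by simp [hj, hval j]⟩

theorem SimUnbounded.freeze {X : Set (Fin n)} (h : V.SimUnbounded c X) (A : Set (Fin n)) :
    (V.freeze A).SimUnbounded c (X \ A) := by
  classical
  intro B
  obtain ⟨ρ, rfl, hB⟩ := h B
  refine ⟨ρ.freeze A, ?_, fun i hi => ?_⟩
  · exact Prod.ext rfl (Set.piecewise_same _ _)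
  · exact (hB i hi.1).trans_eq (Set.piecewise_eq_of_notMem _ _ _ hi.2).symm

theorem Run.exists_embedsOff_of_freeze (ρ : (V.freeze A).Run) :
    ∃ K : ℕ, ∀ x : Fin n → ℕ, (∀ j ∉ A, x j = ρ.first.2 j) → (∀ j ∈ A, K ≤ x j) →
      ∃ ρ' : V.Run, ρ'.first = (ρ.first.1, x) ∧ ∃ ι, ι 0 = 0 ∧ ρ.EmbedsOff A ρ' ι := by
  classical
  choose b hb _ hval using fun i => step_freeze_iff.mp (ρ.step i)
  let effect (i : Fin (ρ.length + 1)) (j : Fin n) : ℤ := Fin.partialSum (fun k => b k j) i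
  obtain ⟨K, hK⟩ : ∃ K, ∀ i j, (effect i j).natAbs ≤ K := by
    obtain ⟨K, hK⟩ := Finite.bddAbove_range fun p : Fin (ρ.length + 1) × Fin n =>
      (effect p.1 p.2).natAbs
    exact ⟨K, fun i j => hK ⟨(i, j), rfl⟩⟩
  refine ⟨K, fun x hx hxA => ?_⟩
  let y (i : Fin (ρ.length + 1)) (j : Fin n) : ℕ :=
    if j ∈ A then (x j + effect i j).toNat else (ρ.conf i).2 j
  have hyA : ∀ i, ∀ j ∈ A, (y i j : ℤ) = x j + effect i j := fun i j hj => by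
    have := hK i j
    have := hxA j hj
    simp only [y, if_pos hj]
    omega
  have hyA' : ∀ i, ∀ j ∉ A, y i j = (ρ.conf i).2 j := fun i j hj => if_neg hj
  have hstep : ∀ i : Fin ρ.length,
      V.Step ((ρ.conf i.castSucc).1, y i.castSucc) ((ρ.conf i.succ).1, y i.succ) := fun i => by
    refine ⟨b i, hb i, fun j => ?_⟩
    by_cases hj : j ∈ A
    · simp only [hyA _ j hj, effect, Fin.partialSum_succ, add_assoc]
    · simp only [hyA' _ j hj, hval i j hj]
  refine ⟨⟨ρ.length, fun i => ((ρ.conf i).1, y i), hstep⟩, Prod.ext rfl (funext fun j => ?_),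
    id, rfl, monotone_id, rfl, fun _ => rfl, hyA'⟩
  by_cases hj : j ∈ A
  · exact show y 0 j = x j by simpa [effect] using hyA 0 j hj
  · exact (hyA' 0 j hj).trans (hx j hj).symm

namespace DisjointnessSeq

/-- The disjointness sequence with the only member `A`. -/
def single (A : Set (Fin n)) (hA : A.Nonempty) : DisjointnessSeq n where
  K := 1
  K_pos := one_pos
  X _ := A
  nonempty _ := hA
  disjoint l l' hne := absurd (Subsingleton.elim l l') hne

/-- The disjointness sequence with first member `A`, followed by the members of `σ`. -/
def cons (A : Set (Fin n)) (σ : DisjointnessSeq n) (hA : A.Nonempty)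
    (hdisj : ∀ l, Disjoint A (σ.X l)) : DisjointnessSeq n where
  K := σ.K + 1
  K_pos := Nat.succ_pos _
  X := Fin.cons A σ.X
  nonempty := Fin.cases hA σ.nonempty
  disjoint := by
    refine Fin.cases (Fin.cases (absurd rfl) fun l _ => ?_) fun l =>
      Fin.cases (fun _ => ?_) fun l' hne => ?_
    · exact (hdisj l).inter_eq
    · exact (hdisj l).symm.inter_eq
    · exact σ.disjoint l l' (mt (congrArg Fin.succ) hne)

variable {σ : DisjointnessSeq n} {hA : A.Nonempty} {hdisj : ∀ l, Disjoint A (σ.X l)}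

theorem lastIdx_cons : (σ.cons A hA hdisj).lastIdx = σ.lastIdx.succ :=
  Fin.ext (Nat.sub_add_cancel σ.K_pos).symm

theorem iUnion_X_cons : ⋃ l, (σ.cons A hA hdisj).X l = A ∪ ⋃ l, σ.X l := by
  ext j
  simp only [Set.mem_union, Set.mem_iUnion]
  exact Fin.exists_fin_succ

end DisjointnessSeq

namespace Run

variable {σ : DisjointnessSeq n}

theorem satisfiesPB_single {ρ : V.Run} (p : Fin (ρ.length + 1))
    (hq : (ρ.conf p).1 = ρ.last.1) (hle : (ρ.conf p).2 ≤ ρ.last.2) (hA : A.Nonempty)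
    (hlt : ∀ j ∈ A, (ρ.conf p).2 j < ρ.last.2 j) :
    ρ.SatisfiesPB (.single A hA) :=
  ⟨fun _ => p, fun _ => Fin.last _, fun _ => p.le_last,
    fun l l' hl => absurd (Subsingleton.elim (α := Fin 1) l l') hl.ne, rfl, fun _ => hq,
    fun _ => hlt, fun _ j _ hj => absurd (hle j) hj.not_ge⟩

/-- The segments of `ρ` may change the components in `A` in an arbitrary way in `ρ'`, because these
belong to the first member of the new sequence. -/
theorem SatisfiesPB.cons {ρ : W.Run} (h : ρ.SatisfiesPB σ) {ρ' : V.Run}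
    {ι : Fin (ρ.length + 1) → Fin (ρ'.length + 1)} (hι : ρ.EmbedsOff A ρ' ι)
    {p q : Fin (ρ'.length + 1)} (hpq : p ≤ q) (hq : q ≤ ι 0)
    (hstate : (ρ'.conf p).1 = (ρ'.conf q).1) (hle : (ρ'.conf p).2 ≤ (ρ'.conf q).2)
    (hlt : ∀ j ∈ A, (ρ'.conf p).2 j < (ρ'.conf q).2 j) (hA : A.Nonempty)
    (hdisj : ∀ l, Disjoint A (σ.X l)) :
    ρ'.SatisfiesPB (σ.cons A hA hdisj) := by
  obtain ⟨s, e, hse, hes, hlast, hloop, hstrict, hnonstrict⟩ := h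
  refine ⟨Fin.cons p (ι ∘ s), Fin.cons q (ι ∘ e), Fin.cases hpq fun l => hι.mono (hse l), ?_, ?_,
    Fin.cases hstate fun l => ?_, Fin.cases hlt fun l j hj => ?_,
    Fin.cases (fun j _ hj => absurd (hle j) hj.not_ge) fun l j hj hdec => ?_⟩
  · refine Fin.cases (Fin.cases (fun h => absurd h (lt_irrefl _)) fun l' _ => ?_) fun l =>
      Fin.cases (fun h => absurd h (Fin.not_lt_zero _)) fun l' hll' => ?_
    · exact hq.trans (hι.mono (Fin.zero_le _))
    · exact hι.mono (hes l l' (Fin.succ_lt_succ_iff.mp hll'))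
  · rw [DisjointnessSeq.lastIdx_cons]
    exact (congrArg ι hlast).trans hι.map_last
  · exact (hι.state_eq _).trans ((hloop l).trans (hι.state_eq _).symm)
  · have hjA : j ∉ A := fun hjA => (hdisj l).ne_of_mem hjA hj rfl
    change (ρ'.conf (ι (s l))).2 j < (ρ'.conf (ι (e l))).2 j
    simpa only [hι.coord_eq _ j hjA] using hstrict l j hj
  · by_cases hjA : j ∈ A
    · exact ⟨(0 : Fin (σ.K + 1)), Fin.succ_pos l, hjA⟩
    · change (ρ'.conf (ι (e l))).2 j < (ρ'.conf (ι (s l))).2 j at hdec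
      simp only [hι.coord_eq _ j hjA] at hdec
      obtain ⟨l', hl', hj'⟩ := hnonstrict l j hj hdec
      exact ⟨l'.succ, Fin.succ_lt_succ_iff.mpr hl', hj'⟩

theorem SatisfiesPB.subset_activeComponents {ρ : V.Run} (h : ρ.SatisfiesPB σ) (l : Fin σ.K) :
    σ.X l ⊆ V.activeComponents := by
  obtain ⟨s, e, hse, -, -, -, hstrict, -⟩ := h
  exact fun j hj => by_contra fun hactive =>
    (hstrict l j hj).ne' ((ρ.reach (hse l)).eq_of_notMem_activeComponents hactive)

end Run

theorem Reach.exists_satisfiesPB_single {v : Fin n → ℕ} (hcs : V.Reach c s)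
    (hloop : V.Reach s (VASS.shift s v)) (hv : (Function.support v).Nonempty) :
    ∃ ρ : V.Run, ρ.first = c ∧ ρ.SatisfiesPB (.single (Function.support v) hv) := by
  obtain ⟨ρ, rfl, hlast⟩ := reach_iff_exists_run.mp hloop
  obtain ⟨ρ', hfirst, ι, hι⟩ := hcs.exists_embedsOff
  have hs : ρ'.conf (ι 0) = ρ.first := hι.conf_eq 0
  have he : ρ'.last = VASS.shift ρ.first v := by
    rw [← hlast, Run.last, ← hι.map_last]
    exact hι.conf_eq _
  refine ⟨ρ', hfirst, Run.satisfiesPB_single (ι 0) ?_ ?_ hv fun j hj => ?_⟩ <;> rw [hs, he]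
  · rfl
  · exact le_self_add
  · exact Nat.lt_add_of_pos_right (Nat.pos_of_ne_zero hj)

theorem Reach.exists_satisfiesPB_cons {v : Fin n → ℕ} (hcs : V.Reach c s)
    (hloop : V.Reach s (VASS.shift s v)) (hv : (Function.support v).Nonempty)
    {ρ : (V.freeze (Function.support v)).Run} (hρ : ρ.first = VASS.shift s v)
    {σ : DisjointnessSeq n} (hσ : ρ.SatisfiesPB σ) :
    ∃ ρ' : V.Run, ρ'.first = c ∧
      ∃ hdisj, ρ'.SatisfiesPB (σ.cons (Function.support v) hv hdisj) := by
  have hdisj : ∀ l, Disjoint (Function.support v) (σ.X l) := fun l =>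
    Set.disjoint_sdiff_right.mono_right <|
      activeComponents_freeze (V := V) ▸ hσ.subset_activeComponents l
  obtain ⟨K, hK⟩ := ρ.exists_embedsOff_of_freeze
  let e := VASS.shift s ((K + 1) • v)
  have hse : V.Reach s e := hloop.iterate (K + 1)
  obtain ⟨ρ₁, hfirst₁, ι₁, hι₁_zero, hι₁⟩ := hK e.2
    (fun j hj => by simp [e, hρ, VASS.shift, Function.notMem_support.mp hj])
    (fun j hj => by
      have := Nat.le_mul_of_pos_right (K + 1) (Nat.pos_of_ne_zero hj)
      simp only [e, VASS.shift, Pi.add_apply, Pi.smul_apply, smul_eq_mul]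
      omega)
  replace hfirst₁ : ρ₁.first = e := hfirst₁.trans (by rw [hρ]; rfl)
  obtain ⟨ρ₂, hfirst₂, ι₂, hι₂⟩ := Reach.exists_embedsOff (hfirst₁ ▸ hse)
  obtain ⟨ρ₃, hfirst₃, ι₃, hι₃⟩ := Reach.exists_embedsOff (hfirst₂ ▸ hcs)
  have hs : ρ₃.conf (ι₃ 0) = s := (hι₃.conf_eq 0).trans hfirst₂
  have he : ρ₃.conf (ι₃ (ι₂ 0)) = e := (hι₃.conf_eq _).trans ((hι₂.conf_eq 0).trans hfirst₁)
  refine ⟨ρ₃, hfirst₃, hdisj, hσ.cons ((hι₁.trans hι₂).trans hι₃) (hι₃.mono (Fin.zero_le (ι₂ 0)))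
    (by simp [hι₁_zero]) ?_ ?_ (fun j hj => ?_) hv hdisj⟩ <;> rw [hs, he]
  · rfl
  · exact le_self_add
  · exact Nat.lt_add_of_pos_right (Nat.mul_pos K.succ_pos (Nat.pos_of_ne_zero hj))

theorem SimUnbounded.exists_satisfiesPB {X : Set (Fin n)} (hX : X.Nonempty)
    (h : V.SimUnbounded c X) :
    ∃ ρ : V.Run, ρ.first = c ∧ ∃ σ : DisjointnessSeq n,
      ρ.SatisfiesPB σ ∧ X ⊆ (⋃ l, σ.X l) ∧ (X ∩ σ.X σ.lastIdx).Nonempty := by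
  induction hm : V.activeComponents.ncard using Nat.strong_induction_on generalizing V c X with
  | _ m ih =>
  obtain ⟨s, v, hv, hcs, hloop, hu⟩ := h.exists_loop hX
  let A := Function.support v
  have hA : A.Nonempty := Function.support_nonempty_iff.mpr hv
  by_cases hXA : X ⊆ A
  · obtain ⟨ρ, hfirst, hρ⟩ := hcs.exists_satisfiesPB_single hloop hA
    exact ⟨ρ, hfirst, _, hρ, hXA.trans (Set.subset_iUnion_of_subset (0 : Fin 1) subset_rfl),
      hX.mono (Set.subset_inter subset_rfl hXA)⟩
  · have hactive : A ⊆ V.activeComponents := fun j hj => by_contra fun hj' => hj <| by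
      simpa [shift] using hloop.eq_of_notMem_activeComponents hj'
    have hlt : (V.freeze A).activeComponents.ncard < m := by
      rw [activeComponents_freeze, ← hm]
      exact Set.ncard_lt_ncard (hactive.sdiff_ssubset_of_nonempty hA)
    obtain ⟨ρ, hfirst, σ, hσ, hcover, hlast⟩ :=
      ih _ hlt (Set.sdiff_nonempty.mpr hXA) (hu.freeze A) rfl
    obtain ⟨ρ', hfirst', hdisj, hρ'⟩ := hcs.exists_satisfiesPB_cons hloop hA hfirst hσ
    refine ⟨ρ', hfirst', _, hρ', ?_, ?_⟩
    · rw [DisjointnessSeq.iUnion_X_cons]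
      exact Set.sdiff_subset_iff.mp hcover
    · rw [DisjointnessSeq.lastIdx_cons]
      exact hlast.mono (Set.inter_subset_inter_left _ Set.sdiff_subset)

theorem Reach.shift_add_sub (h : V.Reach s e) (hq : s.1 = e.1) {v : Fin n → ℕ}
    (hv : s.2 ≤ v + e.2) : V.Reach (VASS.shift s v) (VASS.shift s (v + e.2 - s.2)) := by
  have hend : VASS.shift s (v + e.2 - s.2) = VASS.shift e v :=
    Prod.ext hq <| (add_tsub_cancel_of_le hv).trans (add_comm v e.2)
  exact hend ▸ h.shift v

theorem Reach.exists_iterate (h : V.Reach s e) (hq : s.1 = e.1) {P : Set (Fin n)}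
    (hA : ∀ j ∈ A, s.2 j < e.2 j) (hP : ∀ j ∉ P, s.2 j ≤ e.2 j) {D : ℕ} (hD : ∀ j ∈ P, s.2 j ≤ D)
    (M B : ℕ) {v : Fin n → ℕ} (hv : ∀ j ∈ P, B + M * D ≤ v j) :
    ∃ w, V.Reach (VASS.shift s v) (VASS.shift s w) ∧ (∀ j ∈ P, B ≤ w j) ∧ ∀ j ∈ A, M ≤ w j := by
  induction M generalizing B with
  | zero => exact ⟨v, .refl, by simpa using hv, fun _ _ => Nat.zero_le _⟩
  | succ M ih =>
    obtain ⟨w, hw, hwP, hwA⟩ := ih (B + D) fun j hj => by linarith [hv j hj]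
    have hpass : s.2 ≤ w + e.2 := fun j => by
      by_cases hj : j ∈ P
      · exact (hD j hj).trans <| (Nat.le_add_left D B).trans <|
          (hwP j hj).trans (Nat.le_add_right _ _)
      · exact (hP j hj).trans (Nat.le_add_left _ _)
    refine ⟨w + e.2 - s.2, hw.trans (h.shift_add_sub hq hpass), fun j hj => ?_, fun j hj => ?_⟩ <;>
      simp only [Pi.add_apply, Pi.sub_apply]
    · have := hwP j hj
      have := hD j hj
      omega
    · have := hwA j hj
      have := hA j hj
      omega

theorem Reach.exists_pump (h : V.Reach s e) (hq : s.1 = e.1) {P : Set (Fin n)}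
    (hA : ∀ j ∈ A, s.2 j < e.2 j) (hP : ∀ j ∉ P, s.2 j ≤ e.2 j) (B : ℕ) :
    ∃ K : ℕ, ∀ v : Fin n → ℕ, (∀ j ∈ P, K ≤ v j) →
      ∃ w, V.Reach (VASS.shift s v) (VASS.shift s w) ∧ ∀ j ∈ P ∪ A, B ≤ w j := by
  obtain ⟨D, hD⟩ := Finite.bddAbove_range s.2
  refine ⟨B + B * D, fun v hv => ?_⟩
  obtain ⟨w, hw, hwP, hwA⟩ := h.exists_iterate hq hA hP (fun j _ => hD ⟨j, rfl⟩) B B hv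
  exact ⟨w, hw, fun j hj => hj.elim (hwP j) (hwA j)⟩

theorem Run.SatisfiesPB.exists_reach_shift {ρ : V.Run} {σ : DisjointnessSeq n}
    (h : ρ.SatisfiesPB σ) (B : ℕ) :
    ∃ v, V.Reach ρ.first (shift ρ.last v) ∧ ∀ j ∈ ⋃ l, σ.X l, B ≤ v j := by
  obtain ⟨s, e, hse, hes, -, hq, hstrict, hnonstrict⟩ := h
  have hprefix : ∀ k ≤ σ.K, ∀ p, (∀ l, l.val < k → e l ≤ p) → ∀ B : ℕ,
      ∃ v, V.Reach ρ.first (shift (ρ.conf p) v) ∧ ∀ l, l.val < k → ∀ j ∈ σ.X l, B ≤ v j := by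
    intro k
    induction k with
    | zero =>
      exact fun _ p _ B =>
        ⟨0, (shift_zero (ρ.conf p)).symm ▸ ρ.reach (Fin.zero_le p), fun l hl => absurd hl (by simp)⟩
    | succ k ih =>
      intro hk p hp B
      let m : Fin σ.K := ⟨k, hk⟩
      let P : Set (Fin n) := {j | ∃ l < m, j ∈ σ.X l}
      have hP : ∀ j ∉ P, (ρ.conf (s m)).2 j ≤ (ρ.conf (e m)).2 j := fun j hj => by
        by_cases hjm : j ∈ σ.X m
        · exact (hstrict m j hjm).le
        · exact not_lt.mp (mt (hnonstrict m j hjm) hj)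
      obtain ⟨K, hK⟩ := (ρ.reach (hse m)).exists_pump (hq m) (hstrict m) hP B
      obtain ⟨v, hv, hvK⟩ := ih (Nat.le_of_succ_le hk) (s m) (fun l hl => hes l m hl) K
      obtain ⟨w, hw, hwB⟩ := hK v fun j ⟨l, hl, hj⟩ => hvK l hl j hj
      have hrest : V.Reach (ρ.conf (s m)) (ρ.conf p) :=
        ρ.reach ((hse m).trans (hp m (Nat.lt_succ_self k)))
      refine ⟨w, (hv.trans hw).trans (hrest.shift w), fun l hl j hj => hwB j ?_⟩
      rcases Nat.lt_succ_iff_lt_or_eq.mp hl with hlt | heq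
      · exact Or.inl ⟨l, hlt, hj⟩
      · have hlm : l = m := Fin.ext heq
        exact Or.inr (hlm ▸ hj)
  obtain ⟨v, hv, hvB⟩ := hprefix σ.K le_rfl (Fin.last _) (fun l _ => (e l).le_last) B
  exact ⟨v, hv, fun j hj => let ⟨l, hl⟩ := Set.mem_iUnion.mp hj; hvB l l.2 j hl⟩

theorem Run.SatisfiesPB.simUnbounded {ρ : V.Run} {σ : DisjointnessSeq n} (h : ρ.SatisfiesPB σ) :
    V.SimUnbounded ρ.first (⋃ l, σ.X l) :=
  simUnbounded_iff_forall_exists_reach.mpr fun B =>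
    let ⟨_, hv, hB⟩ := h.exists_reach_shift B
    ⟨_, hv, fun i hi => (hB i hi).trans (Nat.le_add_left _ _)⟩

theorem SimUnbounded.mono {X Y : Set (Fin n)} (hXY : X ⊆ Y) (h : V.SimUnbounded c Y) :
    V.SimUnbounded c X := fun B =>
  let ⟨ρ, hρ, hB⟩ := h B
  ⟨ρ, hρ, fun i hi => hB i (hXY hi)⟩

end VASS

theorem mainTheorem6_general {Q : Type*} {n : ℕ} (V : VASS Q n) (c₀ : VASS.Config Q n) :
    (∀ X : Set (Fin n), X.Nonempty →
      (V.SimUnbounded c₀ X ↔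
        ∃ ρ : V.Run, ρ.first = c₀ ∧ ∃ σ : VASS.DisjointnessSeq n,
          ρ.SatisfiesPB σ ∧ X ⊆ (⋃ l, σ.X l) ∧ (X ∩ σ.X σ.lastIdx).Nonempty)) ∧
    (∀ i : Fin n,
      (V.PlaceUnbounded c₀ i ↔
        ∃ ρ : V.Run, ρ.first = c₀ ∧ ∃ σ : VASS.DisjointnessSeq n,
          ρ.SatisfiesPB σ ∧ i ∈ σ.X σ.lastIdx)) := by
  refine ⟨fun X hX => ⟨fun h => h.exists_satisfiesPB hX, ?_⟩, fun i => ⟨fun h => ?_, ?_⟩⟩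
  · rintro ⟨ρ, rfl, σ, hσ, hcover, -⟩
    exact hσ.simUnbounded.mono hcover
  · obtain ⟨ρ, hfirst, σ, hσ, -, hlast⟩ := h.exists_satisfiesPB (Set.singleton_nonempty i)
    exact ⟨ρ, hfirst, σ, hσ, Set.singleton_inter_nonempty.mp hlast⟩
  · rintro ⟨ρ, rfl, σ, hσ, hi⟩
    exact hσ.simUnbounded.mono (Set.singleton_subset_iff.mpr (Set.mem_iUnion_of_mem _ hi))

theorem mainTheorem6 {Q : Type*} [Finite Q] {n : ℕ} (V : VASS Q n) (c₀ : VASS.Config Q n) :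
    (∀ X : Set (Fin n), X.Nonempty →
      (V.SimUnbounded c₀ X ↔
        ∃ ρ : V.Run, ρ.first = c₀ ∧ ∃ σ : VASS.DisjointnessSeq n,
          ρ.SatisfiesPB σ ∧ X ⊆ (⋃ l, σ.X l) ∧ (X ∩ σ.X σ.lastIdx).Nonempty)) ∧
    (∀ i : Fin n,
      (V.PlaceUnbounded c₀ i ↔
        ∃ ρ : V.Run, ρ.first = c₀ ∧ ∃ σ : VASS.DisjointnessSeq n,
          ρ.SatisfiesPB σ ∧ i ∈ σ.X σ.lastIdx)) :=
  mainTheorem6_general V c₀
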